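/- Let $I\subseteq\mathbb R$ be an interval (bounded or not) with interior $I^\circ$, let $m\ge 1$, and for $i=1,2$ let $c_{i,0},\dots,c_{i,m-1}:I\to\mathbb R$ be continuous. Let $\mathcal L_i=D^m+c_{i,m-1}D^{m-1}+\dots+c_{i,0}$ and assume that $\mathcal L_ih=0$ has $m$ linearly independent solutions, each bounded on $I$. Let $y_i$ be a zero-mean Gaussian process on $I$ driven by the forward SDE $\mathcal L_i y_i=W_i$ with white noise $W_i$ of spectrum $1$; that is, almost all paths of $y_i$ are $C^{m-1}$, the state $(y_i,y_i',\dots,y_i^{(m-1)})$ is a Gaussian process adapted to a filtration for which $B_i$ is a Brownian motion on $I$, and almost surely $$y_i^{(m-1)}(t)-y_i^{(m-1)}(s)+\int_s^t\sum_{k<m}c_{i,k}(r)\,y_i^{(k)}(r)\,dr=B_i(t)-B_i(s)\qquad(s\le t\text{ in }I).$$ Let $K_i(t,s)=\mathbb E[y_i(t)y_i(s)]$, and let $D_t$ be the derivative in the first variable (one-sided at the endpoints of $I$). Then, for every $s\in I$, $K_1(\cdot,s)$ and $K_2(\cdot,s)$ are $C^{m-1}$ on $I$, and the following holds for every $\tau\in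 I^\circ$. Left system. Let $N=I^\circ\cap[\tau,\infty)$ and $E=I\cap(-\infty,\tau]$, and let $V$ be the space of functions on $N$ spanned by all pointwise products $fg$ with $$f\in\operatorname{span}\{D_t^{(j)}K_1(t,\cdot)|_{t=\tau}:0\le j\le m-1\},\qquad g\in\operatorname{span}\{D_t^{(j)}K_2(t,\cdot)|_{t=\tau}:0\le j\le m-1\}.$$ Let $\psi=(\psi_1,\dots,\psi_{s_1})$ be any minimal spanning set of $V$. Then $\sum_ja_j\psi(t_j)=0$ is a minimal KP system for the matrix identity $$\sum_{j}a_j\Big[\big(D_t^{(i)}K_1(t,t_j)\big)\big(D_t^{(l)}K_2(t,t_j)\big)\Big]_{i,l=0}^{m-1}=0\qquad\text{for all }t\in E,\tag{$*$}$$ in the following sense. Call points $t_1<\dots<t_n$ of $N$ admissible nodes if one of them is $\tau$ (which is then the first one, $t_1=\tau$). 1. For any $n$, any admissible nodes $t_1<\dots<t_n$ and any $a\in\mathbb R^n$, $\sum_ja_j\psi(t_j)=0$ if and only if $(*)$ holds. For any $s_1+1$ admissible nodes the system $\sum_{j=1}^{s_1+1}a_j\psi(t_j)=0$ has a solution $a\ne0$,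 and all its solutions satisfy $(*)$. 2. If $\chi_1,\dots,\chi_r$ are functions on $N$ such that, for all $r+1$ admissible nodes and all $a\in\mathbb R^{r+1}$, $\sum_{j=1}^{r+1} a_j\chi(t_j)=0$ implies $(*)$, then $r\ge s_1$. 3. For each $1\le n\le s_1$ there are $n$ admissible nodes for which $a=0$ is the only vector satisfying $(*)$. 4. If, for $s_1+1$ admissible nodes and some $k$, the vectors $\psi(t_j)$, $j\ne k$, are linearly independent, then the vectors $a$ satisfying $(*)$ form a line, spanned by a vector with $a_k\neq0$. Right system. The same holds with $N=I^\circ\cap(-\infty,\tau]$ and $E=I\cap[\tau,\infty)$, so that $\tau$ is the last of the nodes, and with a minimal spanning set $\zeta=(\zeta_1,\dots,\zeta_{s_2})$ of the corresponding space $V$ of functions on $N$: for $s_2+1$ nodes $t_1<\dots<t_{s_2+1}=\tau$, $\sum_{j=1}^{s_2+1}a_j\zeta(t_j)=0$ if and only if $(*)$ holds for all $t\ge t_{s_2+1}$ in $I$, and this KP system is minimal in the sense of 1-4. -/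

import Mathlib

open MeasureTheory ProbabilityTheory Set

noncomputable section

namespace KernelPacket

/-- `B` is a Brownian motion on the interval `I` relative to the filtration `𝓕`, described through
its increments (so that `I` may be unbounded below). Its formal derivative is the white noise of
spectrum `1`. -/
structure IsBrownianOn {Ω : Type*} {mΩ : MeasurableSpace Ω} (P : Measure Ω) (I : Set ℝ)
    (𝓕 : Filtration ℝ mΩ) (B : ℝ → Ω → ℝ) : Prop where
  increment_adapted : ∀ s ∈ I, ∀ t ∈ I, s ≤ t → Measurable[𝓕 t] (fun ω => B t ω - B s ω)
  increment_law : ∀ s ∈ I, ∀ t ∈ I, s ≤ t →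
    HasLaw (fun ω => B t ω - B s ω) (gaussianReal 0 (t - s).toNNReal) P
  increment_indep : ∀ s ∈ I, ∀ t ∈ I, s ≤ t →
    Indep (𝓕 s) (MeasurableSpace.comap (fun ω => B t ω - B s ω) inferInstance) P
  continuous_paths : ∀ᵐ ω ∂P, ContinuousOn (fun t => B t ω) I

/-- The `k`-th pathwise derivative `y^{(k)}(t)` on the interval `I`. -/
def pathDeriv {Ω : Type*} (I : Set ℝ) (y : ℝ → Ω → ℝ) (k : ℕ) (t : ℝ) (ω : Ω) : ℝ :=
  iteratedDerivWithin k (fun r => y r ω) I t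

/-- `y` is a centered Gaussian process on the interval `I` driven by the forward SDE
`y^{(m)} + c_{m-1} y^{(m-1)} + ⋯ + c_0 y = W`, with `W` white noise: the paths are `C^{m-1}`, the
equation holds after integration in time, and the state `(y, y', …, y^{(m-1)})` is Gaussian and does
not anticipate the noise. -/
structure IsDrivenBySDE {Ω : Type*} {mΩ : MeasurableSpace Ω} (P : Measure Ω) (I : Set ℝ) {m : ℕ}
    (c : Fin m → ℝ → ℝ) (y : ℝ → Ω → ℝ) : Prop where
  gaussian : IsGaussianProcess (fun (p : Fin m × I) => pathDeriv I y p.1 p.2) P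
  centered : ∀ t ∈ I, ∫ ω, y t ω ∂P = 0
  smooth_paths : ∀ᵐ ω ∂P, ContDiffOn ℝ ((m - 1 : ℕ) : WithTop ℕ∞) (fun t => y t ω) I
  equation : ∃ (𝓕 : Filtration ℝ mΩ) (B : ℝ → Ω → ℝ), IsBrownianOn P I 𝓕 B ∧
    (∀ k : Fin m, ∀ t ∈ I, Measurable[𝓕 t] (pathDeriv I y k t)) ∧
    ∀ᵐ ω ∂P, ∀ s ∈ I, ∀ t ∈ I, s ≤ t →
      pathDeriv I y (m - 1) t ω - pathDeriv I y (m - 1) s ω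
        + ∫ r in s..t, ∑ k : Fin m, c k r * pathDeriv I y k r ω = B t ω - B s ω

/-- The operator `ℒ = D^m + c_{m-1} D^{m-1} + ⋯ + c_0` has, on `I`, `m` linearly independent
fundamental solutions, each of them bounded. -/
def HasBoundedFundamentalSystem (I : Set ℝ) {m : ℕ} (c : Fin m → ℝ → ℝ) : Prop :=
  ∃ h : Fin m → ℝ → ℝ, LinearIndependent ℝ (fun i (t : I) => h i t) ∧
    ∀ i, ContDiffOn ℝ (m : WithTop ℕ∞) (h i) I ∧
      (∀ t ∈ I, iteratedDerivWithin m (h i) I t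
        + ∑ k : Fin m, c k t * iteratedDerivWithin k (h i) I t = 0) ∧
      ∃ C : ℝ, ∀ t ∈ I, |h i t| ≤ C

/-- The covariance kernel `K(t, s)` of the process `y`. -/
def covKernel {Ω : Type*} {_mΩ : MeasurableSpace Ω} (P : Measure Ω) (y : ℝ → Ω → ℝ) (t s : ℝ) : ℝ :=
  cov[y t, y s; P]

/-- `D_t^{(j)} K(t, s)`: the `j`-th derivative in the first variable, on the interval `I`. -/
def kerDeriv (I : Set ℝ) (K : ℝ → ℝ → ℝ) (j : ℕ) (t s : ℝ) : ℝ :=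
  iteratedDerivWithin j (fun u => K u s) I t

/-- `span {D_t^{(j)} K(t, ·) at t = τ : j = 0, …, m - 1}`, a space of functions of the node variable,
which ranges over `N`. -/
def derivSpan (I : Set ℝ) (m : ℕ) (K : ℝ → ℝ → ℝ) (τ : ℝ) (N : Set ℝ) : Submodule ℝ (N → ℝ) :=
  Submodule.span ℝ (range fun (j : Fin m) (s : N) => kerDeriv I K j τ s)

/-- The tensor product of the two derivative spans, as functions of one node variable: the span of
all pointwise products `f * g`, with `f` in the first space and `g` in the second. -/
def tensorSpan (I : Set ℝ) (m : ℕ) (K₁ K₂ : ℝ → ℝ → ℝ) (τ : ℝ) (N : Set ℝ) :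
    Submodule ℝ (N → ℝ) :=
  derivSpan I m K₁ τ N * derivSpan I m K₂ τ N

/-- `ψ` is a minimal spanning set of `V`: it spans `V`, and no family of fewer vectors does. -/
def IsMinimalSpanning {E : Type*} [AddCommGroup E] [Module ℝ E] {s : ℕ} (ψ : Fin s → E)
    (V : Submodule ℝ E) : Prop :=
  Submodule.span ℝ (range ψ) = V ∧
    ∀ (r : ℕ) (χ : Fin r → E), Submodule.span ℝ (range χ) = V → s ≤ r

/-- Nodes for the part `t ≤ τ`: points of the open interval that lie in `[τ, ∞)`. -/
def leftNodes (I : Set ℝ) (τ : ℝ) : Set ℝ := interior I ∩ Ici τ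

/-- Nodes for the part `t ≥ τ`: points of the open interval that lie in `(-∞, τ]`. -/
def rightNodes (I : Set ℝ) (τ : ℝ) : Set ℝ := interior I ∩ Iic τ

/-- `t` is an increasing tuple of nodes in `N`, one of which is `τ`. (For `N = leftNodes I τ` this
means that the first node is `τ`, for `N = rightNodes I τ` that the last one is.) -/
def IsNodes {N : Set ℝ} (τ : ℝ) {n : ℕ} (t : Fin n → N) : Prop :=
  StrictMono t ∧ ∃ j, (t j : ℝ) = τ

/-- The equations `∑_j a_j χ(t_j) = 0` for a vector `χ` of functions. -/
def Solves {N : Set ℝ} {r n : ℕ} (χ : Fin r → N → ℝ) (t : Fin n → N) (a : Fin n → ℝ) : Prop :=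
  ∀ i, ∑ j, a j * χ i (t j) = 0

/-- The matrix identity
`∑_j a_j [(D_u^{(i)} K₁(u, t_j)) (D_u^{(l)} K₂(u, t_j))]_{0 ≤ i, l ≤ m - 1} = 0` for all `u ∈ E`. -/
def KPVanishes (I : Set ℝ) (m : ℕ) (K₁ K₂ : ℝ → ℝ → ℝ) (E : Set ℝ) {N : Set ℝ} {n : ℕ}
    (t : Fin n → N) (a : Fin n → ℝ) : Prop :=
  ∀ u ∈ E, ∀ i l : Fin m, ∑ j, a j * (kerDeriv I K₁ i u (t j) * kerDeriv I K₂ l u (t j)) = 0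

/-- A vector `χ` of `r` functions is a KP system on `r + 1` nodes: whatever the nodes, solving
`∑_j a_j χ(t_j) = 0` makes the matrix identity hold on `E`. -/
def IsKPSystem (I : Set ℝ) (m : ℕ) (K₁ K₂ : ℝ → ℝ → ℝ) (τ : ℝ) (E N : Set ℝ) {r : ℕ}
    (χ : Fin r → N → ℝ) : Prop :=
  ∀ t : Fin (r + 1) → N, IsNodes τ t → ∀ a : Fin (r + 1) → ℝ,
    Solves χ t a → KPVanishes I m K₁ K₂ E t a

/-- `ψ`, a vector of `s` functions, is a minimal KP system for the matrix identity on `E`. -/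
structure IsMinimalKPSystem (I : Set ℝ) (m : ℕ) (K₁ K₂ : ℝ → ℝ → ℝ) (τ : ℝ) (E N : Set ℝ) {s : ℕ}
    (ψ : Fin s → N → ℝ) : Prop where
  /-- The system is a KP system. -/
  system : IsKPSystem I m K₁ K₂ τ E N ψ
  /-- It has a nonzero solution for all nodes. -/
  solvable : ∀ t : Fin (s + 1) → N, IsNodes τ t → ∃ a : Fin (s + 1) → ℝ, a ≠ 0 ∧ Solves ψ t a
  /-- It is equivalent to the matrix identity, for any number of nodes. -/
  equiv : ∀ (n : ℕ) (t : Fin n → N), IsNodes τ t → ∀ a : Fin n → ℝ,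
    Solves ψ t a ↔ KPVanishes I m K₁ K₂ E t a
  /-- No KP system has fewer equations. -/
  least : ∀ (r : ℕ) (χ : Fin r → N → ℝ), IsKPSystem I m K₁ K₂ τ E N χ → s ≤ r
  /-- Fewer than `s + 1` nodes are not enough for a nonzero solution in general. -/
  sharp : ∀ n : ℕ, 1 ≤ n → n ≤ s → ∃ t : Fin n → N, IsNodes τ t ∧
    ∀ a : Fin n → ℝ, KPVanishes I m K₁ K₂ E t a → a = 0
  /-- If the nodes other than the `k`-th are in general position, then the coefficient vectors are
  unique up to a scalar, and the `k`-th node cannot be removed. -/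
  unique : ∀ t : Fin (s + 1) → N, IsNodes τ t → ∀ k : Fin (s + 1),
    LinearIndependent ℝ (fun (j : {j : Fin (s + 1) // j ≠ k}) (i : Fin s) => ψ i (t j)) →
    ∃ a : Fin (s + 1) → ℝ, a k ≠ 0 ∧
      ∀ b : Fin (s + 1) → ℝ, KPVanishes I m K₁ K₂ E t b ↔ ∃ x : ℝ, b = x • a

end KernelPacket

end

/-! The proof rests on the Markov property of the state `(y, …, y^(m-1))`. Let `Z` be square
integrable, known at time `τ` and uncorrelated with the state at `τ`. The noise after `τ` is
independent of `Z`, so the covariances of `y^(k)(t)` with `Z` solve the homogeneous equation for `t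
≥ τ` with zero initial data, and Gronwall makes them vanish.

For `u ≤ τ`, take for `Z` the least squares residual of `y^(i)(u)` on the state at `τ`; for `u ≥ τ`,
take combinations of values `y(s)` with `s ≤ τ` and argue by duality. Either way, as a function of
the node, `D^(i)K(u, ·)` lies in the span of the derivatives at `τ` (`kerDeriv_mem_derivSpan_left`,
`kerDeriv_mem_derivSpan_right`). Hence the matrix identity on all of `E` reduces to the one at `τ`,
which says that `f ↦ ∑ a_j f(t_j)` kills `V`, i.e. solves the system for any family spanning `V`.

What remains is linear algebra (`isMinimalKPSystem_of_mem_derivSpan`): a minimal spanning family is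
a basis, so its value vectors span `ℝ^s` and independent ones can be chosen. Including the node `τ`
requires `ψ(τ) ≠ 0`, which follows from `K_i(τ, τ) ≠ 0` (`covKernel_ne_zero`): `y(τ)` correlates
with the noise just before `τ`.

Derivatives pass through covariances because almost sure convergence to zero of Gaussian variables
is also mean square convergence. -/

noncomputable section

namespace KernelPacket

/-! ### Linear algebra of node systems -/

/-- A minimal spanning family is linearly independent. -/
theorem IsMinimalSpanning.linearIndependent {E : Type*} [AddCommGroup E] [Module ℝ E] {s : ℕ}
    {ψ : Fin s → E} {V : Submodule ℝ E} (h : IsMinimalSpanning ψ V) : LinearIndependent ℝ ψ := by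
  obtain ⟨rfl, hmin⟩ := h
  have : FiniteDimensional ℝ (Submodule.span ℝ (range ψ)) :=
    FiniteDimensional.span_of_finite ℝ (finite_range ψ)
  rw [linearIndependent_iff_card_le_finrank_span, Fintype.card_fin]
  -- A basis of the span is itself a spanning family, so minimality bounds `s` by the dimension.
  let b := Module.finBasis ℝ (Submodule.span ℝ (range ψ))
  refine hmin _ (fun i => (b i : E)) ?_
  have h1 := b.span_eq
  have h2 := congrArg (Submodule.map (Submodule.span ℝ (range ψ)).subtype) h1
  rw [Submodule.map_span, ← range_comp, Submodule.map_top, Submodule.range_subtype] at h2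
  exact h2

/-- The functional `f ↦ ∑ j, a j * f (t j)`. -/
def nodeFunctional {N : Set ℝ} {n : ℕ} (t : Fin n → N) (a : Fin n → ℝ) : (N → ℝ) →ₗ[ℝ] ℝ :=
  ∑ j, a j • LinearMap.proj (t j)

theorem nodeFunctional_apply {N : Set ℝ} {n : ℕ} (t : Fin n → N) (a : Fin n → ℝ) (f : N → ℝ) :
    nodeFunctional t a f = ∑ j, a j * f (t j) := by
  simp [nodeFunctional]

theorem solves_iff_le_ker {N : Set ℝ} {r n : ℕ} (χ : Fin r → N → ℝ) (t : Fin n → N)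
    (a : Fin n → ℝ) :
    Solves χ t a ↔ Submodule.span ℝ (range χ) ≤ LinearMap.ker (nodeFunctional t a) := by
  rw [Submodule.span_le, range_subset_iff]
  simp [Solves, nodeFunctional_apply]

theorem tensorSpan_le_ker_of_kpVanishes {I : Set ℝ} {m : ℕ} {K₁ K₂ : ℝ → ℝ → ℝ} {τ : ℝ}
    {E N : Set ℝ} (hτ : τ ∈ E) {n : ℕ} {t : Fin n → N} {a : Fin n → ℝ}
    (h : KPVanishes I m K₁ K₂ E t a) :
    tensorSpan I m K₁ K₂ τ N ≤ LinearMap.ker (nodeFunctional t a) := by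
  rw [tensorSpan, derivSpan, derivSpan, Submodule.span_mul_span, Submodule.span_le]
  rintro _ ⟨_, ⟨i, rfl⟩, _, ⟨l, rfl⟩, rfl⟩
  simpa [nodeFunctional_apply] using h τ hτ i l

/-- Each matrix entry at `u` is the functional applied to a product of two functions from the spans
at `τ`, hence to an element of the tensor span. -/
theorem kpVanishes_of_tensorSpan_le_ker {I : Set ℝ} {m : ℕ} {K₁ K₂ : ℝ → ℝ → ℝ} {τ : ℝ}
    {E N : Set ℝ}
    (h₁ : ∀ u ∈ E, ∀ i : Fin m, (fun s : N => kerDeriv I K₁ i u s) ∈ derivSpan I m K₁ τ N)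
    (h₂ : ∀ u ∈ E, ∀ i : Fin m, (fun s : N => kerDeriv I K₂ i u s) ∈ derivSpan I m K₂ τ N)
    {n : ℕ} {t : Fin n → N} {a : Fin n → ℝ}
    (h : tensorSpan I m K₁ K₂ τ N ≤ LinearMap.ker (nodeFunctional t a)) :
    KPVanishes I m K₁ K₂ E t a := by
  intro u hu i l
  have := h (Submodule.mul_mem_mul (h₁ u hu i) (h₂ u hu l))
  simpa [nodeFunctional_apply] using this

/-- More vectors than coordinates are linearly dependent. -/
theorem exists_ne_zero_solves {N : Set ℝ} {r n : ℕ} (h : r < n) (χ : Fin r → N → ℝ)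
    (t : Fin n → N) : ∃ a : Fin n → ℝ, a ≠ 0 ∧ Solves χ t a := by
  let L : (Fin n → ℝ) →ₗ[ℝ] (Fin r → ℝ) :=
    LinearMap.pi fun i => ∑ j, χ i (t j) • LinearMap.proj j
  obtain ⟨a, ha, h0⟩ := (LinearMap.ker L).ne_bot_iff.1
    (LinearMap.ker_ne_bot_of_finrank_lt (f := L) (by simpa using h))
  refine ⟨a, h0, fun i => ?_⟩
  have := congrFun (LinearMap.mem_ker.1 ha) i
  simpa [L, mul_comm] using this

/-- Linearly independent functions on `N` have linearly independent value vectors at suitable nodes,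
one of which may be any point where the value vector does not vanish. -/
theorem exists_nodes_linearIndependent {N : Set ℝ} {s : ℕ} {ψ : Fin s → N → ℝ}
    (hψ : LinearIndependent ℝ ψ) (p : N) (hp : (fun i => ψ i p) ≠ 0) {n : ℕ} (hn : 1 ≤ n)
    (hns : n ≤ s) : ∃ t : Fin n → N, StrictMono t ∧ (∃ j, t j = p) ∧
      LinearIndependent ℝ (fun (j : Fin n) (i : Fin s) => ψ i (t j)) := by
  classical
  let v : N → Fin s → ℝ := fun q i => ψ i q
  -- A nonzero functional killing every value vector would be a linear relation among the `ψ i`.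
  have hspan : Submodule.span ℝ (range v) = ⊤ := by
    by_contra hne
    obtain ⟨f, hf0, hf⟩ := Submodule.exists_le_ker_of_lt_top _ (lt_top_iff_ne_top.2 hne)
    apply hf0
    have hsum : ∑ i, f (Pi.single i 1) • ψ i = 0 := by
      ext q
      have h0 : f (v q) = 0 := hf (Submodule.subset_span ⟨q, rfl⟩)
      rw [f.pi_apply_eq_sum_univ (v q)] at h0
      rw [Pi.zero_apply, ← h0, Finset.sum_apply]
      refine Finset.sum_congr rfl fun i _ => ?_
      rw [Pi.smul_apply, smul_eq_mul, smul_eq_mul, mul_comm]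
      congr 2
      ext j
      simp [Pi.single_apply, eq_comm]
    have := Fintype.linearIndependent_iff.1 hψ _ hsum
    apply LinearMap.pi_ext'
    intro i
    ext
    simpa using this i
  have h1 : LinearIndepOn ℝ v {p} := LinearIndepOn.singleton hp
  -- Extend `{p}` to a maximal set of points with independent values. It has at least `s` points, so
  -- `n` of them, `p` included, can be kept and sorted.
  obtain ⟨b, -, hpb, hb, hlin⟩ := exists_linearIndepOn_extension h1 (subset_univ _)
  have hbfin : b.Finite := hlin.finite
  have hcard : s ≤ hbfin.toFinset.card := by
    have h2 : Submodule.span ℝ (v '' b) = ⊤ := by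
      rw [eq_top_iff, ← hspan, ← image_univ]
      exact Submodule.span_le.2 hb
    have h3 := finrank_span_finset_le_card (R := ℝ) (hbfin.toFinset.image v)
    rw [Finset.coe_image, hbfin.coe_toFinset, Set.finrank, h2, finrank_top] at h3
    simpa using h3.trans Finset.card_image_le
  obtain ⟨c, hpc, hcb, hc⟩ := Finset.exists_subsuperset_card_eq (s := {p}) (t := hbfin.toFinset)
    (by simpa using hpb rfl) (by simpa using hn) (hns.trans hcard)
  refine ⟨c.orderEmbOfFin hc, (c.orderEmbOfFin hc).strictMono, ?_, ?_⟩
  · have : p ∈ range (c.orderEmbOfFin hc) := by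
      rw [Finset.range_orderEmbOfFin]; exact hpc (by simp)
    exact this
  · have hc' : LinearIndepOn ℝ v (c : Set N) := hlin.mono fun q hq => by simpa using hcb hq
    exact LinearIndependent.comp hc' (fun j => ⟨c.orderEmbOfFin hc j, Finset.orderEmbOfFin_mem c hc j⟩)
      fun i j hij => (c.orderEmbOfFin hc).injective (congrArg Subtype.val hij)

/-- The relations between `s + 1` vectors of `ℝ^s`, all but the `k`-th of them independent. -/
theorem exists_forall_solves_iff {N : Set ℝ} {s : ℕ} (ψ : Fin s → N → ℝ) (t : Fin (s + 1) → N)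
    (k : Fin (s + 1))
    (h : LinearIndependent ℝ (fun (j : {j : Fin (s + 1) // j ≠ k}) (i : Fin s) => ψ i (t j))) :
    ∃ a : Fin (s + 1) → ℝ, a k ≠ 0 ∧
      ∀ b : Fin (s + 1) → ℝ, Solves ψ t b ↔ ∃ x : ℝ, b = x • a := by
  have key : ∀ b : Fin (s + 1) → ℝ, Solves ψ t b → b k = 0 → b = 0 := by
    intro b hb hk
    have h1 := Fintype.linearIndependent_iff.1 h (fun j => b j) (by
      ext i
      have h2 := hb i
      rw [Fintype.sum_eq_add_sum_subtype_ne _ k] at h2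
      simpa [hk] using h2)
    ext j
    by_cases hj : j = k
    · rw [hj, hk]; rfl
    · exact h1 ⟨j, hj⟩
  have hadd : ∀ (b c : Fin (s + 1) → ℝ) (x : ℝ), Solves ψ t b → Solves ψ t c →
      Solves ψ t (b - x • c) := by
    intro b c x hb hc i
    have h1 : ∑ j, (b - x • c) j * ψ i (t j)
        = ∑ j, b j * ψ i (t j) - x * ∑ j, c j * ψ i (t j) := by
      rw [Finset.mul_sum, ← Finset.sum_sub_distrib]
      exact Finset.sum_congr rfl fun j _ => by simp; ring
    rw [h1, hb i, hc i]; ring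
  obtain ⟨a, ha0, ha⟩ := exists_ne_zero_solves (Nat.lt_succ_self s) ψ t
  have hak : a k ≠ 0 := fun h0 => ha0 (key a ha h0)
  refine ⟨a, hak, fun b => ⟨fun hb => ⟨b k / a k, ?_⟩, ?_⟩⟩
  · refine sub_eq_zero.1 (key _ (hadd b a _ hb ha) ?_)
    simp [div_mul_cancel₀ _ hak]
  · rintro ⟨x, rfl⟩ i
    have := ha i
    simp only [Pi.smul_apply, smul_eq_mul, mul_assoc, ← Finset.mul_sum, this, mul_zero]

/-- If the derivatives of the kernels at all points of `E` lie in the spans of the derivatives at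
`τ`, then every minimal spanning set of the product space is a minimal KP system. -/
theorem isMinimalKPSystem_of_mem_derivSpan {I : Set ℝ} {m : ℕ} (hm : 0 < m) {K₁ K₂ : ℝ → ℝ → ℝ}
    {τ : ℝ} {E N : Set ℝ} (hτE : τ ∈ E) (hτN : τ ∈ N)
    (h₁ : ∀ u ∈ E, ∀ i : Fin m, (fun s : N => kerDeriv I K₁ i u s) ∈ derivSpan I m K₁ τ N)
    (h₂ : ∀ u ∈ E, ∀ i : Fin m, (fun s : N => kerDeriv I K₂ i u s) ∈ derivSpan I m K₂ τ N)
    (hne₁ : K₁ τ τ ≠ 0) (hne₂ : K₂ τ τ ≠ 0) {s : ℕ} {ψ : Fin s → N → ℝ}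
    (hψ : IsMinimalSpanning ψ (tensorSpan I m K₁ K₂ τ N)) :
    IsMinimalKPSystem I m K₁ K₂ τ E N ψ := by
  have equiv : ∀ (n : ℕ) (t : Fin n → N) (a : Fin n → ℝ),
      Solves ψ t a ↔ KPVanishes I m K₁ K₂ E t a := by
    intro n t a
    rw [solves_iff_le_ker, hψ.1]
    exact ⟨kpVanishes_of_tensorSpan_le_ker h₁ h₂, tensorSpan_le_ker_of_kpVanishes hτE⟩
  -- Otherwise the single node `τ` with coefficient `1` solves the system, and the `(0, 0)` entry at
  -- `u = τ` gives `K₁ τ τ * K₂ τ τ = 0`.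
  have hp : (fun i => ψ i ⟨τ, hτN⟩) ≠ 0 := by
    intro h0
    have hsol : Solves ψ (fun _ : Fin 1 => (⟨τ, hτN⟩ : N)) (fun _ => 1) := fun i => by
      simpa using congrFun h0 i
    have := (equiv _ _ _).1 hsol τ hτE ⟨0, hm⟩ ⟨0, hm⟩
    simp [kerDeriv, hne₁, hne₂] at this
  have sharp : ∀ n : ℕ, 1 ≤ n → n ≤ s → ∃ t : Fin n → N, IsNodes τ t ∧
      ∀ a : Fin n → ℝ, KPVanishes I m K₁ K₂ E t a → a = 0 := by
    intro n hn hns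
    obtain ⟨t, ht, ⟨j, hj⟩, hlin⟩ :=
      exists_nodes_linearIndependent hψ.linearIndependent ⟨τ, hτN⟩ hp hn hns
    refine ⟨t, ⟨ht, j, by rw [hj]⟩, fun a ha => ?_⟩
    funext j
    refine Fintype.linearIndependent_iff.1 hlin a ?_ j
    ext i
    simpa using (equiv _ _ _).2 ha i
  refine ⟨fun t _ a => (equiv _ t a).1, fun t _ => exists_ne_zero_solves (Nat.lt_succ_self s) ψ t,
    fun n t _ a => equiv n t a, fun r χ hχ => ?_, sharp, fun t _ k hk => ?_⟩
  -- With `r < s`, the `r` equations at `r + 1` sharp nodes have a nonzero solution, contradicting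
  -- `sharp`.
  · by_contra hlt
    obtain ⟨t, ht, h0⟩ := sharp (r + 1) (by omega) (by omega)
    obtain ⟨a, ha0, ha⟩ := exists_ne_zero_solves (Nat.lt_succ_self r) χ t
    exact ha0 (h0 a (hχ t ht a ha))
  · obtain ⟨a, hak, ha⟩ := exists_forall_solves_iff ψ t k hk
    exact ⟨a, hak, fun b => by rw [← equiv, ha]⟩

open Filter Topology

/-! ### Gaussian convergence and covariances -/

section Probability

variable {Ω : Type*} {mΩ : MeasurableSpace Ω} {P : Measure Ω} [IsProbabilityMeasure P]

omit [IsProbabilityMeasure P] in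
theorem sq_integral_mul_le {X Z : Ω → ℝ} (hX : MemLp X 2 P) (hZ : MemLp Z 2 P) :
    (∫ ω, X ω * Z ω ∂P) ^ 2 ≤ (∫ ω, X ω ^ 2 ∂P) * ∫ ω, Z ω ^ 2 ∂P := by
  have h : ∀ x : ℝ, 0 ≤ (∫ ω, X ω ^ 2 ∂P) * (x * x) + (2 * ∫ ω, X ω * Z ω ∂P) * x
      + ∫ ω, Z ω ^ 2 ∂P := by
    intro x
    have h1 : 0 ≤ ∫ ω, (x * X ω + Z ω) ^ 2 ∂P := integral_nonneg fun ω => sq_nonneg _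
    have h2 : ∫ ω, (x * X ω + Z ω) ^ 2 ∂P
        = ∫ ω, (x * x) * X ω ^ 2 + (2 * x) * (X ω * Z ω) + Z ω ^ 2 ∂P :=
      integral_congr_ae (Eventually.of_forall fun ω => by ring)
    have i1 := hX.integrable_sq.const_mul (x * x)
    have i2 : Integrable (fun ω => 2 * x * (X ω * Z ω)) P :=
      (hX.integrable_mul hZ).const_mul (2 * x)
    have i3 : Integrable (fun ω => x * x * X ω ^ 2 + 2 * x * (X ω * Z ω)) P := i1.add i2
    rw [h2, integral_add i3 hZ.integrable_sq, integral_add i1 i2, integral_const_mul,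
      integral_const_mul] at h1
    linarith
  have := discrim_le_zero h
  rw [discrim] at this
  nlinarith

/-- The characteristic function at `1` has modulus `exp (-Var / 2)`, whatever the mean, and tends to
`1` by dominated convergence. -/
theorem variance_tendsto_zero_of_gaussian {ι : Type*} {l : Filter ι} [l.IsCountablyGenerated]
    {X : ι → Ω → ℝ} (hX : ∀ᶠ i in l, HasGaussianLaw (X i) P)
    (h0 : ∀ᵐ ω ∂P, Tendsto (fun i => X i ω) l (𝓝 0)) :
    Tendsto (fun i => Var[X i; P]) l (𝓝 0) := by
  have h1 : Tendsto (fun i => ∫ ω, Complex.exp (X i ω * Complex.I) ∂P) l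
      (𝓝 (∫ _ω, (1 : ℂ) ∂P)) := by
    refine tendsto_integral_filter_of_dominated_convergence (fun _ => 1) ?_ ?_
      (integrable_const _) ?_
    · filter_upwards [hX] with i hi
      have := hi.aemeasurable
      exact AEMeasurable.aestronglyMeasurable (by fun_prop)
    · exact Eventually.of_forall fun i => Eventually.of_forall fun ω => by
        rw [Complex.norm_exp_ofReal_mul_I]
    · filter_upwards [h0] with ω hω
      have h2 : Tendsto (fun x : ℝ => Complex.exp (x * Complex.I)) (𝓝 0) (𝓝 1) := by
        have : Continuous fun x : ℝ => Complex.exp (x * Complex.I) := by fun_prop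
        simpa using this.tendsto 0
      exact h2.comp hω
  have h2 : ∀ᶠ i in l, -2 * Real.log ‖∫ ω, Complex.exp (X i ω * Complex.I) ∂P‖ = Var[X i; P] := by
    filter_upwards [hX] with i hi
    have e1 : ∫ ω, Complex.exp (X i ω * Complex.I) ∂P = charFun (P.map (X i)) 1 := by
      rw [charFun_apply_real, integral_map hi.aemeasurable (by fun_prop)]
      simp
    rw [e1, hi.map_eq_gaussianReal, charFun_gaussianReal, Complex.norm_exp, Real.log_exp]
    simp [Real.coe_toNNReal _ (variance_nonneg (X i) P)]
    ring
  refine Tendsto.congr' h2 ?_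
  have h3 := (Real.continuousAt_log one_ne_zero).tendsto.comp (by simpa using h1.norm)
  simpa using h3.const_mul (-2)

/-- For real Gaussian variables almost sure convergence implies mean square convergence. -/
theorem integral_sq_tendsto_zero_of_gaussian {ι : Type*} {l : Filter ι} [l.IsCountablyGenerated]
    {X : ι → Ω → ℝ} (hX : ∀ᶠ i in l, HasGaussianLaw (X i) P)
    (h0 : ∀ᵐ ω ∂P, Tendsto (fun i => X i ω) l (𝓝 0)) :
    Tendsto (fun i => ∫ ω, X i ω ^ 2 ∂P) l (𝓝 0) := by
  have hv := variance_tendsto_zero_of_gaussian hX h0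
  have h1 : Tendsto (fun i => ∫ ω, min 1 |X i ω| ∂P) l (𝓝 (∫ _ω, (0 : ℝ) ∂P)) := by
    refine tendsto_integral_filter_of_dominated_convergence (fun _ => 1) ?_ ?_
      (integrable_const _) ?_
    · filter_upwards [hX] with i hi
      have := hi.aemeasurable
      exact AEMeasurable.aestronglyMeasurable (by fun_prop)
    · exact Eventually.of_forall fun i => Eventually.of_forall fun ω => by
        rw [Real.norm_of_nonneg (by positivity)]; exact min_le_left _ _
    · filter_upwards [h0] with ω hω
      have h2 : Tendsto (fun x : ℝ => min 1 |x|) (𝓝 0) (𝓝 0) := by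
        have : Continuous fun x : ℝ => min 1 |x| := by fun_prop
        simpa using this.tendsto 0
      exact h2.comp hω
  -- The mean is controlled by `min 1 |E X| ≤ E (min 1 |X|) + E |X - E X|`; truncation supplies the
  -- dominating function, and the last term is at most `√Var`.
  have h2 : Tendsto (fun i => min 1 |P[X i]|) l (𝓝 0) := by
    have h3 : Tendsto (fun i => ∫ ω, min 1 |X i ω| ∂P + √(Var[X i; P])) l (𝓝 0) := by
      simpa using h1.add hv.sqrt
    refine tendsto_of_tendsto_of_tendsto_of_le_of_le' tendsto_const_nhds h3
      (Eventually.of_forall fun i => by positivity) ?_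
    filter_upwards [hX] with i hi
    have hL := hi.memLp_two
    have hd : MemLp (fun ω => |X i ω - P[X i]|) 2 P := (hL.sub (memLp_const _)).abs
    have hmin : Integrable (fun ω => min 1 |X i ω|) P := by
      have := hi.aemeasurable
      exact Integrable.of_bound (AEMeasurable.aestronglyMeasurable (by fun_prop)) 1
        (Eventually.of_forall fun ω => by
          rw [Real.norm_of_nonneg (by positivity)]; exact min_le_left _ _)
    have h4 : min 1 |P[X i]| ≤ ∫ ω, (min 1 |X i ω| + |X i ω - P[X i]|) ∂P := by
      have : ∫ _ω : Ω, min 1 |P[X i]| ∂P = min 1 |P[X i]| := by simp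
      rw [← this]
      refine integral_mono (integrable_const _) (hmin.add (hd.integrable one_le_two)) fun ω => ?_
      have h5 : |P[X i]| ≤ |X i ω| + |X i ω - P[X i]| := by
        have := abs_sub_abs_le_abs_sub (P[X i]) (X i ω)
        rw [abs_sub_comm] at this
        linarith
      have := abs_nonneg (X i ω - P[X i])
      dsimp only
      rcases le_total 1 |X i ω| with h | h
      · rw [min_eq_left h]; linarith [min_le_left 1 |P[X i]|]
      · rw [min_eq_right h]; linarith [min_le_right 1 |P[X i]|]
    rw [integral_add hmin (hd.integrable one_le_two)] at h4
    refine h4.trans (add_le_add_right (Real.le_sqrt_of_sq_le ?_) _)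
    have h6 := sq_integral_mul_le hd (memLp_const (1 : ℝ))
    rw [variance_eq_integral hi.aemeasurable]
    simpa using h6
  have h3 : Tendsto (fun i => P[X i]) l (𝓝 0) := by
    rw [tendsto_zero_iff_abs_tendsto_zero]
    refine Tendsto.congr' ?_ h2
    filter_upwards [h2.eventually_lt_const one_pos] with i hi
    exact min_eq_right (by simpa using (min_lt_iff.1 hi).resolve_left (lt_irrefl _) |>.le)
  have h4 : Tendsto (fun i => Var[X i; P] + P[X i] ^ 2) l (𝓝 0) := by
    simpa using hv.add (h3.pow 2)
  refine Tendsto.congr' ?_ h4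
  filter_upwards [hX] with i hi
  rw [variance_eq_sub hi.memLp_two]
  simp

omit [IsProbabilityMeasure P] in
theorem integral_mul_tendsto_zero {ι : Type*} {l : Filter ι}
    {X : ι → Ω → ℝ} (hX : ∀ᶠ i in l, MemLp (X i) 2 P)
    (h0 : Tendsto (fun i => ∫ ω, X i ω ^ 2 ∂P) l (𝓝 0)) {Z : Ω → ℝ} (hZ : MemLp Z 2 P) :
    Tendsto (fun i => ∫ ω, X i ω * Z ω ∂P) l (𝓝 0) := by
  have h1 : Tendsto (fun i => (∫ ω, X i ω ^ 2 ∂P) * ∫ ω, Z ω ^ 2 ∂P) l (𝓝 0) := by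
    simpa using h0.mul_const (∫ ω, Z ω ^ 2 ∂P)
  have h2 : Tendsto (fun i => (∫ ω, X i ω * Z ω ∂P) ^ 2) l (𝓝 0) := by
    refine tendsto_of_tendsto_of_tendsto_of_le_of_le' tendsto_const_nhds h1
      (Eventually.of_forall fun i => by positivity) ?_
    filter_upwards [hX] with i hi using sq_integral_mul_le hi hZ
  rw [tendsto_zero_iff_abs_tendsto_zero]
  simpa [Function.comp_def, Real.sqrt_sq_eq_abs] using h2.sqrt

theorem covariance_eq_integral_mul_sub {X Z : Ω → ℝ} (hZ : Integrable Z P)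
    (hXZ : Integrable (fun ω => X ω * (Z ω - P[Z])) P) :
    cov[X, Z; P] = ∫ ω, X ω * (Z ω - P[Z]) ∂P := by
  have h1 : ∫ ω, (Z ω - P[Z]) ∂P = 0 := by
    rw [integral_sub hZ (integrable_const _)]; simp
  have h2 : cov[X, Z; P] = ∫ ω, (X ω * (Z ω - P[Z]) - P[X] * (Z ω - P[Z])) ∂P :=
    integral_congr_ae (Eventually.of_forall fun ω => by ring)
  have hZ' : Integrable (fun ω => Z ω - P[Z]) P := hZ.sub (integrable_const _)
  rw [h2, integral_sub hXZ (hZ'.const_mul _), integral_const_mul, h1]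
  ring

theorem covariance_tendsto_zero {ι : Type*} {l : Filter ι}
    {X : ι → Ω → ℝ} (hX : ∀ᶠ i in l, MemLp (X i) 2 P)
    (h0 : Tendsto (fun i => ∫ ω, X i ω ^ 2 ∂P) l (𝓝 0)) {Z : Ω → ℝ} (hZ : MemLp Z 2 P) :
    Tendsto (fun i => cov[X i, Z; P]) l (𝓝 0) := by
  have hZ' : MemLp (fun ω => Z ω - P[Z]) 2 P := hZ.sub (memLp_const _)
  refine Tendsto.congr' ?_ (integral_mul_tendsto_zero hX h0 hZ')
  filter_upwards [hX] with i hi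
  exact (covariance_eq_integral_mul_sub (hZ.integrable one_le_two)
    (hi.integrable_mul hZ')).symm

theorem covariance_eq_zero_of_variance_eq_zero {X Z : Ω → ℝ} (hX : MemLp X 2 P)
    (h : Var[X; P] = 0) : cov[X, Z; P] = 0 := by
  rw [covariance, integral_congr_ae (g := fun _ => 0), integral_zero]
  filter_upwards [ae_eq_integral_of_variance_eq_zero hX h] with ω hω
  simp [hω]

omit [IsProbabilityMeasure P] in
theorem covariance_congr_left {X X' Z : Ω → ℝ} (h : X =ᵐ[P] X') :
    cov[X, Z; P] = cov[X', Z; P] := by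
  rw [covariance, covariance, integral_congr_ae h]
  exact integral_congr_ae (h.mono fun ω hω => congrArg (fun x => (x - P[X']) * (Z ω - P[Z])) hω)

/-- Covariances of time integrals of continuous mean square bounded processes. -/
theorem covariance_intervalIntegral {X : ℝ → Ω → ℝ} {s t : ℝ} (hst : s ≤ t)
    (hmeas : ∀ r ∈ Icc s t, Measurable (X r))
    (hcont : ∀ᵐ ω ∂P, ContinuousOn (fun r => X r ω) (Icc s t))
    (hX : ∀ r ∈ Icc s t, MemLp (X r) 2 P) {C : ℝ} (hC : ∀ r ∈ Icc s t, ∫ ω, X r ω ^ 2 ∂P ≤ C)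
    {Z : Ω → ℝ} (hZ : MemLp Z 2 P) :
    cov[fun ω => ∫ r in s..t, X r ω, Z; P] = ∫ r in s..t, cov[X r, Z; P] := by
  classical
  obtain ⟨A, hAsub, hAmeas, hA⟩ := exists_measurable_superset_of_null (ae_iff.1 hcont)
  -- A modification all of whose paths are continuous on `ℝ`: zero on a null set, constant in time
  -- outside `[s, t]`. This gives the joint measurability needed for Fubini.
  let U : ℝ → Ω → ℝ := fun r => Aᶜ.indicator (X (projIcc s t hst r))
  have hUae : ∀ᵐ ω ∂P, ∀ r ∈ Icc s t, U r ω = X r ω := by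
    have : ∀ᵐ ω ∂P, ω ∈ Aᶜ := compl_mem_ae_iff.2 hA
    filter_upwards [this] with ω hω r hr
    simp only [U, indicator_of_mem hω, projIcc_of_mem hst hr]
  have hUmeas : Measurable (Function.uncurry U) := by
    refine measurable_uncurry_of_continuous_of_measurable (fun ω => ?_) fun r =>
      (hmeas _ (projIcc s t hst r).2).indicator hAmeas.compl
    by_cases hω : ω ∈ Aᶜ
    · have h1 : ContinuousOn (fun r => X r ω) (Icc s t) := by
        by_contra h
        exact hω (hAsub h)
      simp only [U, indicator_of_mem hω]
      exact (continuousOn_iff_continuous_domRestrict.1 h1).comp continuous_projIcc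
    · simp only [U, indicator_of_notMem hω]
      exact continuous_const
  have hUL : ∀ r ∈ Icc s t, U r =ᵐ[P] X r := fun r hr => hUae.mono fun ω h => h r hr
  have hprod : ∀ W : Ω → ℝ, MemLp W 2 P →
      Integrable (Function.uncurry fun ω r => U r ω * W ω)
        (P.prod (volume.restrict (Ioc s t))) := by
    intro W hW
    have hmeasW : AEStronglyMeasurable (Function.uncurry fun ω r => U r ω * W ω)
        (P.prod (volume.restrict (Ioc s t))) :=
      (hUmeas.comp measurable_swap).aestronglyMeasurable.mul hW.1.comp_fst
    have hInt : ∀ r ∈ Icc s t, Integrable (fun ω => U r ω * W ω) P := fun r hr =>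
      (((hX r hr).integrable_mul hW)).congr ((hUL r hr).symm.mul (EventuallyEq.refl _ W))
    rw [integrable_prod_iff' hmeasW]
    refine ⟨?_, ?_⟩
    · filter_upwards [ae_restrict_mem measurableSet_Ioc] with r hr
      exact hInt r (Ioc_subset_Icc_self hr)
    · refine Integrable.of_bound hmeasW.norm.prod_swap.integral_prod_right' ((C + ∫ ω, W ω ^ 2 ∂P) / 2) ?_
      filter_upwards [ae_restrict_mem measurableSet_Ioc] with r hr
      have hr' := Ioc_subset_Icc_self hr
      rw [Real.norm_of_nonneg (integral_nonneg fun _ => norm_nonneg _)]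
      have h1 : ∫ ω, ‖U r ω * W ω‖ ∂P ≤ ∫ ω, (X r ω ^ 2 + W ω ^ 2) / 2 ∂P := by
        refine integral_mono_ae (hInt r hr').norm
          (((hX r hr').integrable_sq.add hW.integrable_sq).div_const 2) ?_
        filter_upwards [hUL r hr'] with ω hω
        rw [hω, Real.norm_eq_abs, abs_le]
        constructor <;> nlinarith [sq_nonneg (X r ω + W ω), sq_nonneg (X r ω - W ω)]
      refine h1.trans ?_
      rw [integral_div, integral_add (hX r hr').integrable_sq hW.integrable_sq]
      linarith [hC r hr']
  have hI : (fun ω => ∫ r in s..t, X r ω) =ᵐ[P] fun ω => ∫ r in Ioc s t, U r ω := by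
    filter_upwards [hUae] with ω hω
    rw [intervalIntegral.integral_of_le hst]
    exact setIntegral_congr_fun measurableSet_Ioc fun r hr => (hω r (Ioc_subset_Icc_self hr)).symm
  have hZ' : MemLp (fun ω => Z ω - P[Z]) 2 P := hZ.sub (memLp_const _)
  have hIZ : Integrable (fun ω => (∫ r in Ioc s t, U r ω) * (Z ω - P[Z])) P := by
    simpa [integral_mul_const] using (hprod _ hZ').integral_prod_left
  have hcov : cov[fun ω => ∫ r in s..t, X r ω, Z; P]
      = cov[fun ω => ∫ r in Ioc s t, U r ω, Z; P] := covariance_congr_left hI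
  rw [hcov, covariance_eq_integral_mul_sub (hZ.integrable one_le_two) hIZ,
    intervalIntegral.integral_of_le hst]
  have hswap := integral_integral_swap (hprod _ hZ')
  simp only [integral_mul_const] at hswap
  rw [hswap]
  refine setIntegral_congr_fun measurableSet_Ioc fun r hr => ?_
  have hr' := Ioc_subset_Icc_self hr
  rw [covariance_eq_integral_mul_sub (hZ.integrable one_le_two)
    ((hX r hr').integrable_mul hZ')]
  exact integral_congr_ae ((hUL r hr').mul (EventuallyEq.refl _ _))

/-- Least squares: the covariances of `X` with finitely many variables are those of a linear
combination of them. -/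
theorem exists_covariance_eq_sum {ι : Type*} [Fintype ι] {X : Ω → ℝ} {Y : ι → Ω → ℝ}
    (hX : MemLp X 2 P) (hY : ∀ k, MemLp (Y k) 2 P) :
    ∃ β : ι → ℝ, ∀ l, cov[X, Y l; P] = ∑ k, β k * cov[Y k, Y l; P] := by
  let L : (Ω → ℝ) → (ι → ℝ) →ₗ[ℝ] ℝ := fun W => ∑ l, cov[W, Y l; P] • LinearMap.proj l
  have hL : ∀ W, MemLp W 2 P → ∀ v, L W v = cov[W, fun ω => ∑ l, v l * Y l ω; P] := by
    intro W hW v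
    rw [covariance_fun_sum_right (fun l => (hY l).const_mul (v l)) hW]
    simp only [covariance_const_mul_right]
    simp [L, mul_comm]
  -- If `v` is killed by every row of the Gram matrix, `∑ v_l Y_l` has variance zero and so no
  -- covariance with `X`. The Gram matrix may therefore be singular.
  have hmem : L X ∈ Submodule.span ℝ (range fun k => L (Y k)) := by
    refine mem_span_of_iInf_ker_le_ker fun v hv => ?_
    rw [LinearMap.mem_ker, hL X hX, covariance_comm]
    have hV : MemLp (fun ω => ∑ l, v l * Y l ω) 2 P :=
      memLp_finsetSum _ fun l _ => (hY l).const_mul (v l)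
    refine covariance_eq_zero_of_variance_eq_zero hV ?_
    rw [← covariance_self hV.aemeasurable,
      covariance_fun_sum_left (fun l => (hY l).const_mul (v l)) hV]
    refine Finset.sum_eq_zero fun k _ => ?_
    rw [covariance_const_mul_left, ← hL _ (hY k), LinearMap.mem_ker.1 ((Submodule.mem_iInf _).1 hv k),
      mul_zero]
  obtain ⟨β, hβ⟩ := (Submodule.mem_span_range_iff_exists_fun ℝ).1 hmem
  classical
  refine ⟨β, fun l => ?_⟩
  have := LinearMap.congr_fun hβ (Pi.single l 1)
  simpa [L, Pi.single_apply] using this.symm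

end Probability

/-! ### Gronwall estimates for the companion system -/

section Companion

/-- `g = (g_0, g_1, …)` solves the companion system of `D^m + c_{m-1} D^{m-1} + ⋯ + c_0` on `[a, b]`
with constant right hand side `e` and zero initial data. -/
structure IsCompanionSolution {m : ℕ} (c : Fin m → ℝ → ℝ) (a b e : ℝ) (g : ℕ → ℝ → ℝ) : Prop where
  continuousOn : ∀ k < m, ContinuousOn (g k) (Icc a b)
  hasDeriv : ∀ k, k + 1 < m → ∀ r ∈ Icc a b, HasDerivWithinAt (g k) (g (k + 1) r) (Icc a b) r
  hasDeriv_last : ∀ r ∈ Icc a b, HasDerivWithinAt (g (m - 1))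
    (e - ∑ k : Fin m, c k r * g k r) (Icc a b) r
  initial : ∀ k < m, g k a = 0

variable {m : ℕ} {c : Fin m → ℝ → ℝ} {a b e : ℝ} {g : ℕ → ℝ → ℝ}

theorem abs_sum_mul_le {K : ℝ} {r : ℝ} (hK : ∑ k, |c k r| ≤ K) :
    |∑ k : Fin m, c k r * g k r| ≤ K * ‖fun k : Fin m => g k r‖ := by
  refine (Finset.abs_sum_le_sum_abs _ _).trans ?_
  refine le_trans ?_ (mul_le_mul_of_nonneg_right hK (norm_nonneg _))
  rw [Finset.sum_mul]
  refine Finset.sum_le_sum fun k _ => ?_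
  rw [abs_mul]
  exact mul_le_mul_of_nonneg_left (norm_le_pi_norm (fun k : Fin m => g k r) k) (abs_nonneg _)

/-- Gronwall in the sup norm; `1 ≤ K` covers the components whose derivative is just the next
component. -/
theorem IsCompanionSolution.norm_le (hg : IsCompanionSolution c a b e g) {K : ℝ} (hK1 : 1 ≤ K)
    (hK : ∀ r ∈ Icc a b, ∑ k, |c k r| ≤ K) {r : ℝ} (hr : r ∈ Icc a b) :
    ‖fun k : Fin m => g k r‖ ≤ gronwallBound 0 K |e| (r - a) := by
  let G' : ℝ → Fin m → ℝ := fun r k =>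
    if (k : ℕ) + 1 < m then g (k + 1) r else e - ∑ k : Fin m, c k r * g k r
  refine norm_le_gronwallBound_of_norm_deriv_right_le (f := fun r (k : Fin m) => g k r) (f' := G')
    (continuousOn_pi.2 fun k => hg.continuousOn k k.2) ?_ ?_ ?_ r hr
  · intro x hx
    rw [hasDerivWithinAt_pi]
    intro k
    have hx' := Ico_subset_Icc_self hx
    have hnhds : Icc a b ∈ 𝓝[Ici x] x := by
      filter_upwards [Icc_mem_nhdsGE hx.2] with z hz
      exact ⟨hx.1.trans hz.1, hz.2⟩
    refine HasDerivWithinAt.mono_of_mem_nhdsWithin ?_ hnhds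
    by_cases hk : (k : ℕ) + 1 < m
    · simpa [G', hk] using hg.hasDeriv k hk x hx'
    · have h1 := hg.hasDeriv_last x hx'
      rw [show m - 1 = k by omega] at h1
      simpa [G', hk] using h1
  · rw [show (fun k : Fin m => g k a) = 0 from funext fun k => hg.initial k k.2, norm_zero]
  · intro x hx
    have hx' := Ico_subset_Icc_self hx
    have hn := norm_nonneg fun k : Fin m => g k x
    refine (pi_norm_le_iff_of_nonneg (by positivity)).2 fun k => ?_
    by_cases hk : (k : ℕ) + 1 < m
    · have h1 := norm_le_pi_norm (fun k : Fin m => g k x) ⟨k + 1, hk⟩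
      simp only [G', hk, if_true]
      have := abs_nonneg e
      dsimp only at h1
      nlinarith
    · simp only [G', hk, if_false]
      have h1 := abs_sum_mul_le (g := g) (hK x hx')
      have h2 := abs_sub e (∑ k : Fin m, c k x * g k x)
      rw [Real.norm_eq_abs]
      linarith

theorem exists_sum_abs_le (hc : ∀ k, ContinuousOn (c k) (Icc a b)) :
    ∃ K, 1 ≤ K ∧ ∀ r ∈ Icc a b, ∑ k, |c k r| ≤ K := by
  obtain ⟨K, hK⟩ := isCompact_Icc.bddAbove_image (f := fun r => ∑ k, |c k r|) (K := Icc a b)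
    (continuousOn_finsetSum _ fun k _ => (hc k).abs)
  exact ⟨max 1 K, le_max_left _ _, fun r hr => (hK ⟨r, hr, rfl⟩).trans (le_max_right _ _)⟩

theorem IsCompanionSolution.eq_zero (hg : IsCompanionSolution c a b 0 g)
    (hc : ∀ k, ContinuousOn (c k) (Icc a b)) {r : ℝ} (hr : r ∈ Icc a b) {k : ℕ} (hk : k < m) :
    g k r = 0 := by
  obtain ⟨K, hK1, hK⟩ := exists_sum_abs_le hc
  have h1 := hg.norm_le hK1 hK hr
  rw [abs_zero, gronwallBound_ε0_δ0] at h1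
  have h2 := (norm_le_pi_norm (fun k : Fin m => g k r) ⟨k, hk⟩).trans h1
  exact norm_le_zero_iff.1 h2

/-- On a short interval the solution with right hand side `1` and zero initial data is positive. -/
theorem IsCompanionSolution.pos (hm : 0 < m) (hg : IsCompanionSolution c a b 1 g) {K : ℝ}
    (hK1 : 1 ≤ K) (hK : ∀ r ∈ Icc a b, ∑ k, |c k r| ≤ K)
    (hsmall : K * gronwallBound 0 K 1 (b - a) < 1) {r : ℝ} (hr : r ∈ Ioc a b) {k : ℕ}
    (hk : k < m) : 0 < g k r := by
  have key : ∀ k < m, ∀ g' : ℝ → ℝ, (∀ r ∈ Icc a b, HasDerivWithinAt (g k) (g' r) (Icc a b) r) →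
      (∀ r ∈ Ioo a b, 0 < g' r) → ∀ r ∈ Ioc a b, 0 < g k r := by
    intro k hk g' hd hpos r hr
    have hmono : StrictMonoOn (g k) (Icc a b) := by
      refine strictMonoOn_of_deriv_pos (convex_Icc a b) (hg.continuousOn k hk) fun x hx => ?_
      rw [interior_Icc] at hx
      rw [((hd x (Ioo_subset_Icc_self hx)).hasDerivAt (Icc_mem_nhds hx.1 hx.2)).deriv]
      exact hpos x hx
    have := hmono ⟨le_rfl, hr.1.le.trans hr.2⟩ (Ioc_subset_Icc_self hr) hr.1
    rwa [hg.initial k hk] at this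
  -- Downward induction from the top component. Its derivative is `1 - ∑ c_k g_k`, positive by
  -- `hsmall`; each lower component starts at `0` with positive derivative.
  have hind : ∀ j k, k + j + 1 = m → ∀ r ∈ Ioc a b, 0 < g k r := by
    intro j
    induction j with
    | zero =>
      intro k hk
      obtain rfl : k = m - 1 := by omega
      refine key (m - 1) (by omega) _ hg.hasDeriv_last fun x hx => ?_
      have hx' := Ioo_subset_Icc_self hx
      have h1 := abs_sum_mul_le (g := g) (hK x hx')
      have h2 := hg.norm_le hK1 hK hx'
      rw [abs_one] at h2
      have h3 := gronwallBound_mono (le_refl (0 : ℝ)) zero_le_one (zero_le_one.trans hK1)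
        (show x - a ≤ b - a by linarith [hx.2])
      have h4 := mul_le_mul_of_nonneg_left (h2.trans h3) (zero_le_one.trans hK1)
      linarith [le_abs_self (∑ k : Fin m, c k x * g k x)]
    | succ j ih =>
      intro k hk
      exact key k (by omega) _ (hg.hasDeriv k (by omega)) fun x hx =>
        ih (k + 1) (by omega) x (Ioo_subset_Ioc_self hx)
  exact hind (m - 1 - k) k (by omega) r hr

end Companion

/-! ### Mean square calculus of the driven process -/

section DrivenProcess

variable {Ω : Type*} {mΩ : MeasurableSpace Ω} {P : Measure Ω} [IsProbabilityMeasure P]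
  {I : Set ℝ} {m : ℕ} {c : Fin m → ℝ → ℝ} {y : ℝ → Ω → ℝ}

theorem pathDeriv_zero (t : ℝ) : pathDeriv I y 0 t = y t := by
  ext ω
  simp [pathDeriv]

omit [IsProbabilityMeasure P] in
theorem IsDrivenBySDE.memLp (hy : IsDrivenBySDE P I c y) {k : ℕ} (hk : k < m) {t : ℝ}
    (ht : t ∈ I) : MemLp (pathDeriv I y k t) 2 P :=
  (hy.gaussian.hasGaussianLaw_eval (⟨k, hk⟩, ⟨t, ht⟩)).memLp_two

omit [IsProbabilityMeasure P] in
theorem IsDrivenBySDE.hasGaussianLaw_sum (hy : IsDrivenBySDE P I c y) {n : ℕ} {k : Fin n → ℕ}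
    (hk : ∀ i, k i < m) {t : Fin n → ℝ} (ht : ∀ i, t i ∈ I) (a : Fin n → ℝ) :
    HasGaussianLaw (fun ω => ∑ i, a i * pathDeriv I y (k i) (t i) ω) P := by
  have h := (hy.gaussian.comp_right fun i : Fin n => ((⟨k i, hk i⟩, ⟨t i, ht i⟩) : Fin m × I)).smul a
  exact h.hasGaussianLaw_fun_sum (I := Finset.univ)

omit [IsProbabilityMeasure P] in
theorem IsDrivenBySDE.ae_continuousOn (hy : IsDrivenBySDE P I c y) (hU : UniqueDiffOn ℝ I) :
    ∀ᵐ ω ∂P, ∀ k < m, ContinuousOn (fun t => pathDeriv I y k t ω) I := by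
  filter_upwards [hy.smooth_paths] with ω hω k hk
  exact ((contDiffOn_nat_iff_continuousOn_differentiableOn_deriv hU).1 hω).1 k (by omega)

omit [IsProbabilityMeasure P] in
theorem IsDrivenBySDE.ae_hasDerivWithinAt (hy : IsDrivenBySDE P I c y) (hU : UniqueDiffOn ℝ I) :
    ∀ᵐ ω ∂P, ∀ k, k + 1 < m → ∀ t ∈ I,
      HasDerivWithinAt (fun t => pathDeriv I y k t ω) (pathDeriv I y (k + 1) t ω) I t := by
  filter_upwards [hy.smooth_paths] with ω hω k hk t ht
  have h := ((contDiffOn_nat_iff_continuousOn_differentiableOn_deriv hU).1 hω).2 k (by omega) t ht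
  have := h.hasDerivWithinAt
  rwa [← iteratedDerivWithin_succ] at this

theorem IsDrivenBySDE.tendsto_integral_sq_sub (hy : IsDrivenBySDE P I c y) (hU : UniqueDiffOn ℝ I)
    {k : ℕ} (hk : k < m) {t : ℝ} (ht : t ∈ I) :
    Tendsto (fun r => ∫ ω, (pathDeriv I y k r ω - pathDeriv I y k t ω) ^ 2 ∂P) (𝓝[I] t) (𝓝 0) := by
  refine integral_sq_tendsto_zero_of_gaussian
    (X := fun r ω => pathDeriv I y k r ω - pathDeriv I y k t ω) ?_ ?_
  · filter_upwards [self_mem_nhdsWithin] with r hr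
    have := hy.hasGaussianLaw_sum (k := ![k, k]) (t := ![r, t]) (by simp [Fin.forall_fin_two, hk])
      (by simp [Fin.forall_fin_two, hr, ht]) ![1, -1]
    simpa [Fin.sum_univ_two, ← sub_eq_add_neg] using this
  · filter_upwards [hy.ae_continuousOn hU] with ω hω
    have h := hω k hk t ht
    simpa using h.tendsto.sub_const (pathDeriv I y k t ω)

/-- Gives second moments bounded on compact intervals, as needed to exchange covariance and time
integral. -/
theorem IsDrivenBySDE.continuousOn_integral_sq (hy : IsDrivenBySDE P I c y)
    (hU : UniqueDiffOn ℝ I) {k : ℕ} (hk : k < m) :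
    ContinuousOn (fun r => ∫ ω, pathDeriv I y k r ω ^ 2 ∂P) I := by
  intro t ht
  have h1 := hy.tendsto_integral_sq_sub hU hk ht
  have hL := hy.memLp hk ht
  have hsub : ∀ᶠ r in 𝓝[I] t,
      MemLp (fun ω => pathDeriv I y k r ω - pathDeriv I y k t ω) 2 P := by
    filter_upwards [self_mem_nhdsWithin] with r hr using (hy.memLp hk hr).sub hL
  have h2 := integral_mul_tendsto_zero hsub h1 hL
  have h3 := (h1.add (h2.const_mul 2)).add_const (∫ ω, pathDeriv I y k t ω ^ 2 ∂P)
  simp only [mul_zero, zero_add] at h3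
  refine Tendsto.congr' ?_ h3
  filter_upwards [hsub] with r hr
  have i1 := hr.integrable_sq
  have i2 : Integrable (fun ω => 2 * ((pathDeriv I y k r ω - pathDeriv I y k t ω)
      * pathDeriv I y k t ω)) P := (hr.integrable_mul hL).const_mul 2
  have i3 : Integrable (fun ω => (pathDeriv I y k r ω - pathDeriv I y k t ω) ^ 2 +
      2 * ((pathDeriv I y k r ω - pathDeriv I y k t ω) * pathDeriv I y k t ω)) P := i1.add i2
  rw [← integral_const_mul, ← integral_add i1 i2, ← integral_add i3 hL.integrable_sq]
  exact integral_congr_ae (Eventually.of_forall fun ω => by dsimp only; ring)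

theorem IsDrivenBySDE.continuousOn_covariance (hy : IsDrivenBySDE P I c y)
    (hU : UniqueDiffOn ℝ I) {k : ℕ} (hk : k < m) {Z : Ω → ℝ} (hZ : MemLp Z 2 P) :
    ContinuousOn (fun r => cov[pathDeriv I y k r, Z; P]) I := by
  intro t ht
  have hL := hy.memLp hk ht
  have h1 := (covariance_tendsto_zero
    (X := fun r ω => pathDeriv I y k r ω - pathDeriv I y k t ω) (by
      filter_upwards [self_mem_nhdsWithin] with r hr using (hy.memLp hk hr).sub hL)
    (hy.tendsto_integral_sq_sub hU hk ht) hZ).add_const cov[pathDeriv I y k t, Z; P]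
  rw [zero_add] at h1
  refine Tendsto.congr' ?_ h1
  filter_upwards [self_mem_nhdsWithin] with r hr
  rw [covariance_fun_sub_left (hy.memLp hk hr) hL hZ]
  ring

/-- The difference quotient minus the derivative is Gaussian and tends to zero almost surely, hence
in mean square. -/
theorem IsDrivenBySDE.hasDerivWithinAt_covariance (hy : IsDrivenBySDE P I c y)
    (hU : UniqueDiffOn ℝ I) {k : ℕ} (hk : k + 1 < m) {Z : Ω → ℝ} (hZ : MemLp Z 2 P) {t : ℝ}
    (ht : t ∈ I) :
    HasDerivWithinAt (fun r => cov[pathDeriv I y k r, Z; P]) cov[pathDeriv I y (k + 1) t, Z; P]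
      I t := by
  have hk' : k < m := by omega
  rw [hasDerivWithinAt_iff_tendsto_slope]
  let X : ℝ → Ω → ℝ := fun r ω =>
    (r - t)⁻¹ * (pathDeriv I y k r ω - pathDeriv I y k t ω) - pathDeriv I y (k + 1) t ω
  have hmem : ∀ᶠ r in 𝓝[I \ {t}] t, r ∈ I := by
    filter_upwards [self_mem_nhdsWithin] with r hr using hr.1
  have hG : ∀ᶠ r in 𝓝[I \ {t}] t, HasGaussianLaw (X r) P := by
    filter_upwards [hmem] with r hr
    have := hy.hasGaussianLaw_sum (k := ![k, k, k + 1]) (t := ![r, t, t])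
      (by simp [Fin.forall_fin_succ, hk, hk']) (by simp [Fin.forall_fin_succ, hr, ht])
      ![(r - t)⁻¹, -(r - t)⁻¹, -1]
    convert this using 2
    simp [X, Fin.sum_univ_three]
    ring
  have h0 : ∀ᵐ ω ∂P, Tendsto (fun r => X r ω) (𝓝[I \ {t}] t) (𝓝 0) := by
    filter_upwards [hy.ae_hasDerivWithinAt hU] with ω hω
    have h := hasDerivWithinAt_iff_tendsto_slope.1 (hω k hk t ht)
    simpa [X, slope_def_module] using h.sub_const (pathDeriv I y (k + 1) t ω)
  have h1 := (covariance_tendsto_zero (hG.mono fun r hr => hr.memLp_two)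
    (integral_sq_tendsto_zero_of_gaussian hG h0) hZ).add_const cov[pathDeriv I y (k + 1) t, Z; P]
  rw [zero_add] at h1
  refine Tendsto.congr' ?_ h1
  filter_upwards [hmem] with r hr
  have e1 := covariance_fun_sub_left (((hy.memLp hk' hr).sub (hy.memLp hk' ht)).const_mul (r - t)⁻¹)
    (hy.memLp hk ht) hZ
  simp only [Pi.sub_apply] at e1
  rw [e1, covariance_const_mul_left, covariance_fun_sub_left (hy.memLp hk' hr) (hy.memLp hk' ht) hZ,
    slope_def_module, smul_eq_mul]
  ring

theorem IsDrivenBySDE.iteratedDerivWithin_covariance (hy : IsDrivenBySDE P I c y)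
    (hU : UniqueDiffOn ℝ I) {k : ℕ} (hk : k < m) {Z : Ω → ℝ} (hZ : MemLp Z 2 P) {t : ℝ}
    (ht : t ∈ I) :
    iteratedDerivWithin k (fun r => cov[y r, Z; P]) I t = cov[pathDeriv I y k t, Z; P] := by
  induction k generalizing t with
  | zero => rw [iteratedDerivWithin_zero, pathDeriv_zero]
  | succ k ih =>
    rw [iteratedDerivWithin_succ, derivWithin_congr (fun r hr => ih (by omega) hr) (ih (by omega) ht)]
    exact (hy.hasDerivWithinAt_covariance hU hk hZ ht).derivWithin (hU t ht)

omit [IsProbabilityMeasure P] in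
theorem IsDrivenBySDE.memLp_zero (hy : IsDrivenBySDE P I c y) (hm : 0 < m) {t : ℝ} (ht : t ∈ I) :
    MemLp (y t) 2 P := by
  have := hy.memLp hm ht
  rwa [pathDeriv_zero] at this

theorem IsDrivenBySDE.kerDeriv_eq (hy : IsDrivenBySDE P I c y) (hU : UniqueDiffOn ℝ I) {k : ℕ}
    (hk : k < m) {t s : ℝ} (ht : t ∈ I) (hs : s ∈ I) :
    kerDeriv I (covKernel P y) k t s = cov[pathDeriv I y k t, y s; P] :=
  hy.iteratedDerivWithin_covariance hU hk (hy.memLp_zero (by omega) hs) ht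

theorem IsDrivenBySDE.contDiffOn_covKernel (hy : IsDrivenBySDE P I c y) (hU : UniqueDiffOn ℝ I)
    (hm : 0 < m) {s : ℝ} (hs : s ∈ I) :
    ContDiffOn ℝ ((m - 1 : ℕ) : WithTop ℕ∞) (fun t => covKernel P y t s) I := by
  have hZ := hy.memLp_zero hm hs
  rw [contDiffOn_nat_iff_continuousOn_differentiableOn_deriv hU]
  refine ⟨fun k hk => ?_, fun k hk => ?_⟩
  · exact (hy.continuousOn_covariance hU (k := k) (by omega) hZ).congr fun t ht =>
      hy.kerDeriv_eq hU (by omega) ht hs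
  · intro t ht
    exact (hy.hasDerivWithinAt_covariance hU (k := k) (by omega) hZ ht).differentiableWithinAt.congr
      (fun t ht => hy.kerDeriv_eq hU (by omega) ht hs) (hy.kerDeriv_eq hU (by omega) ht hs)

/-! ### Covariances with the noise and the Markov property -/

/-- The stochastic equation, tested against a square integrable variable `Z`. -/
theorem IsDrivenBySDE.covariance_equation (hy : IsDrivenBySDE P I c y) (hI : I.OrdConnected)
    (hU : UniqueDiffOn ℝ I) (hm : 0 < m) (hc : ∀ k, ContinuousOn (c k) I)
    (hmeas : ∀ k : Fin m, ∀ t ∈ I, Measurable (pathDeriv I y k t)) {W Z : Ω → ℝ} {s t : ℝ}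
    (hs : s ∈ I) (ht : t ∈ I) (hst : s ≤ t) (hW : MemLp W 2 P) (hZ : MemLp Z 2 P)
    (heq : ∀ᵐ ω ∂P, pathDeriv I y (m - 1) t ω - pathDeriv I y (m - 1) s ω
        + ∫ r in s..t, ∑ k : Fin m, c k r * pathDeriv I y k r ω = W ω) :
    cov[pathDeriv I y (m - 1) t, Z; P] - cov[pathDeriv I y (m - 1) s, Z; P]
      + ∫ r in s..t, ∑ k : Fin m, c k r * cov[pathDeriv I y k r, Z; P] = cov[W, Z; P] := by
  have hsub : Icc s t ⊆ I := hI.out hs ht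
  have hLt := hy.memLp (k := m - 1) (by omega) ht
  have hLs := hy.memLp (k := m - 1) (by omega) hs
  have hX : ∀ r ∈ Icc s t, MemLp (fun ω => ∑ k : Fin m, c k r * pathDeriv I y k r ω) 2 P :=
    fun r hr => memLp_finsetSum _ fun k _ => (hy.memLp k.2 (hsub hr)).const_mul _
  -- Cauchy–Schwarz for the sum over `k` bounds the second moment of the drift by this continuous
  -- function.
  obtain ⟨C, hC⟩ := isCompact_Icc.bddAbove_image (K := Icc s t)
    (f := fun r => (∑ k, c k r ^ 2) * ∑ k : Fin m, ∫ ω, pathDeriv I y k r ω ^ 2 ∂P)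
    ((continuousOn_finsetSum _ fun k _ => ((hc k).mono hsub).pow 2).mul
      (continuousOn_finsetSum _ fun k _ => (hy.continuousOn_integral_sq hU k.2).mono hsub))
  have hint := covariance_intervalIntegral (P := P) (C := C)
    (X := fun r ω => ∑ k : Fin m, c k r * pathDeriv I y k r ω) hst
    (fun r hr => Finset.measurable_fun_sum _ fun k _ => (hmeas k r (hsub hr)).const_mul _)
    (by
      filter_upwards [hy.ae_continuousOn hU] with ω hω
      exact continuousOn_finsetSum _ fun k _ => ((hc k).mono hsub).mul ((hω k k.2).mono hsub))
    hX (fun r hr => by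
      refine le_trans ?_ (hC ⟨r, hr, rfl⟩)
      have hk : ∀ k : Fin m, Integrable (fun ω => pathDeriv I y k r ω ^ 2) P := fun k =>
        (hy.memLp k.2 (hsub hr)).integrable_sq
      dsimp only
      rw [← integral_finsetSum _ fun k _ => hk k, ← integral_const_mul]
      exact integral_mono (hX r hr).integrable_sq
        ((integrable_finsetSum _ fun k _ => hk k).const_mul _) fun ω =>
          Finset.sum_mul_sq_le_sq_mul_sq _ _ _) hZ
  have hint' : ∀ r ∈ Icc s t, cov[fun ω => ∑ k : Fin m, c k r * pathDeriv I y k r ω, Z; P]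
      = ∑ k : Fin m, c k r * cov[pathDeriv I y k r, Z; P] := by
    intro r hr
    rw [covariance_fun_sum_left (fun k => (hy.memLp k.2 (hsub hr)).const_mul _) hZ]
    simp only [covariance_const_mul_left]
  rw [intervalIntegral.integral_congr (g := fun r =>
    ∑ k : Fin m, c k r * cov[pathDeriv I y k r, Z; P])
    (fun r hr => hint' r (by rwa [uIcc_of_le hst] at hr))] at hint
  have hae : (fun ω => ∫ r in s..t, ∑ k : Fin m, c k r * pathDeriv I y k r ω)
      =ᵐ[P] fun ω => (W - pathDeriv I y (m - 1) t) ω + pathDeriv I y (m - 1) s ω := by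
    filter_upwards [heq] with ω hω
    simp only [Pi.sub_apply]
    linarith
  rw [covariance_congr_left hae] at hint
  have h2 := covariance_add_left (hW.sub hLt) hLs hZ
  rw [covariance_sub_left hW hLt hZ] at h2
  have h3 := h2.symm.trans hint
  linarith

/-- Covariances with a variable that is uncorrelated with the state at the time `a`, and whose
covariance with the noise is linear in time, solve the companion system after the time `a`. -/
theorem IsDrivenBySDE.isCompanionSolution (hy : IsDrivenBySDE P I c y) (hI : I.OrdConnected)
    (hU : UniqueDiffOn ℝ I) (hm : 0 < m) (hc : ∀ k, ContinuousOn (c k) I)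
    (hmeas : ∀ k : Fin m, ∀ t ∈ I, Measurable (pathDeriv I y k t)) {B : ℝ → Ω → ℝ}
    (hB : ∀ s ∈ I, ∀ t ∈ I, s ≤ t → MemLp (fun ω => B t ω - B s ω) 2 P)
    (heq : ∀ᵐ ω ∂P, ∀ s ∈ I, ∀ t ∈ I, s ≤ t →
      pathDeriv I y (m - 1) t ω - pathDeriv I y (m - 1) s ω
        + ∫ r in s..t, ∑ k : Fin m, c k r * pathDeriv I y k r ω = B t ω - B s ω)
    {Z : Ω → ℝ} (hZ : MemLp Z 2 P) {a b e : ℝ} (ha : a ∈ I) (hb : b ∈ I)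
    (h0 : ∀ k < m, cov[pathDeriv I y k a, Z; P] = 0)
    (hBZ : ∀ r ∈ Icc a b, cov[fun ω => B r ω - B a ω, Z; P] = e * (r - a)) :
    IsCompanionSolution c a b e (fun k r => cov[pathDeriv I y k r, Z; P]) := by
  have hsub : Icc a b ⊆ I := hI.out ha hb
  refine ⟨fun k hk => (hy.continuousOn_covariance hU hk hZ).mono hsub,
    fun k hk r hr => (hy.hasDerivWithinAt_covariance hU hk hZ (hsub hr)).mono hsub, ?_, h0⟩
  intro r hr
  have hf : ContinuousOn (fun r => ∑ k : Fin m, c k r * cov[pathDeriv I y k r, Z; P]) (Icc a b) :=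
    continuousOn_finsetSum _ fun k _ =>
      ((hc k).mono hsub).mul ((hy.continuousOn_covariance hU k.2 hZ).mono hsub)
  have heqr : ∀ r ∈ Icc a b, cov[pathDeriv I y (m - 1) r, Z; P] = e * (r - a) -
      ∫ x in a..r, ∑ k : Fin m, c k x * cov[pathDeriv I y k x, Z; P] := by
    intro r hr
    have h1 := hy.covariance_equation hI hU hm hc hmeas ha (hsub hr) hr.1
      (hB a ha r (hsub hr) hr.1) hZ (heq.mono fun ω h => h a ha r (hsub hr) hr.1)
    rw [h0 (m - 1) (by omega), hBZ r hr] at h1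
    linarith
  have : Fact (r ∈ Icc a b) := ⟨hr⟩
  have hInt : HasDerivWithinAt
      (fun u => ∫ x in a..u, ∑ k : Fin m, c k x * cov[pathDeriv I y k x, Z; P])
      (∑ k : Fin m, c k r * cov[pathDeriv I y k r, Z; P]) (Icc a b) r :=
    intervalIntegral.integral_hasDerivWithinAt_right
      ((hf.mono (Icc_subset_Icc_right hr.2)).intervalIntegrable_of_Icc hr.1)
      (hf.stronglyMeasurableAtFilter_nhdsWithin measurableSet_Icc r) (hf r hr)
  have hlin : HasDerivWithinAt (fun u : ℝ => e * (u - a)) e (Icc a b) r := by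
    simpa using (((hasDerivAt_id r).sub_const a).const_mul e).hasDerivWithinAt
  exact (hlin.sub hInt).congr heqr (heqr r hr)

omit [IsProbabilityMeasure P] in
theorem IsBrownianOn.memLp {𝓕 : Filtration ℝ mΩ} {B : ℝ → Ω → ℝ} (hB : IsBrownianOn P I 𝓕 B)
    {s t : ℝ} (hs : s ∈ I) (ht : t ∈ I) (hst : s ≤ t) : MemLp (fun ω => B t ω - B s ω) 2 P :=
  (hB.increment_law s hs t ht hst).hasGaussianLaw.memLp_two

omit [IsProbabilityMeasure P] in
theorem IsBrownianOn.covariance_eq_zero {𝓕 : Filtration ℝ mΩ} {B : ℝ → Ω → ℝ}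
    (hB : IsBrownianOn P I 𝓕 B) {s t : ℝ} (hs : s ∈ I) (ht : t ∈ I) (hst : s ≤ t) {Z : Ω → ℝ}
    (hZ : MemLp Z 2 P) (hZm : Measurable[𝓕 s] Z) : cov[fun ω => B t ω - B s ω, Z; P] = 0 := by
  rw [covariance_comm]
  refine IndepFun.covariance_eq_zero ?_ hZ (hB.memLp hs ht hst)
  rw [IndepFun_iff_Indep]
  exact indep_of_indep_of_le_left (hB.increment_indep s hs t ht hst) hZm.comap_le

theorem IsBrownianOn.covariance_increment {𝓕 : Filtration ℝ mΩ} {B : ℝ → Ω → ℝ}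
    (hB : IsBrownianOn P I 𝓕 B) {a r b : ℝ} (ha : a ∈ I) (hr : r ∈ I) (hb : b ∈ I) (har : a ≤ r)
    (hrb : r ≤ b) : cov[fun ω => B r ω - B a ω, fun ω => B b ω - B a ω; P] = r - a := by
  have h1 := hB.memLp ha hr har
  have h2 := hB.memLp hr hb hrb
  have e : (fun ω => B b ω - B a ω) = (fun ω => B r ω - B a ω) + fun ω => B b ω - B r ω := by
    ext ω
    simp
  rw [e, covariance_add_right h1 h1 h2, covariance_self h1.aemeasurable, covariance_comm,
    hB.covariance_eq_zero hr hb hrb h1 (hB.increment_adapted a ha r hr har),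
    (hB.increment_law a ha r hr har).variance_eq, variance_id_gaussianReal,
    Real.coe_toNNReal _ (sub_nonneg.2 har), add_zero]

/-- The noise makes the variance of `y` positive at interior points. -/
theorem IsDrivenBySDE.covKernel_ne_zero (hy : IsDrivenBySDE P I c y) (hI : I.OrdConnected)
    (hU : UniqueDiffOn ℝ I) (hm : 0 < m) (hc : ∀ k, ContinuousOn (c k) I) {τ : ℝ}
    (hτ : τ ∈ interior I) : covKernel P y τ τ ≠ 0 := by
  obtain ⟨𝓕, B, hB, hadapt, heq⟩ := hy.equation
  have hτI := interior_subset hτ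
  obtain ⟨ε, hε, hball⟩ := Metric.mem_nhds_iff.1 (mem_interior_iff_mem_nhds.1 hτ)
  have haI : ∀ a, τ - ε / 2 ≤ a → a ≤ τ → a ∈ I := fun a h1 h2 =>
    hball (by rw [Metric.mem_ball, Real.dist_eq, abs_lt]; constructor <;> linarith)
  obtain ⟨K, hK1, hK⟩ := exists_sum_abs_le (c := c) (a := τ - ε / 2) (b := τ)
    fun k => (hc k).mono fun a ha => haI a ha.1 ha.2
  have hcont : Tendsto (fun x => K * gronwallBound 0 K 1 x) (𝓝 0) (𝓝 (K * 0)) := by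
    have := (hasDerivAt_gronwallBound 0 K 1 0).continuousAt.tendsto.const_mul K
    rwa [gronwallBound_x0] at this
  have hev := hcont.eventually_lt_const (u := 1) (by simp)
  obtain ⟨δ, hδ, hδK⟩ := Metric.eventually_nhds_iff.1 hev
  -- Close enough to `τ` to stay in `I` and to make the Gronwall bound small. The test variable is
  -- the increment `B τ - B a`, whose covariance with `B r - B a` is `r - a`, so `e = 1`.
  let a := max (τ - ε / 2) (τ - δ / 2)
  have h1 : τ - ε / 2 ≤ a := le_max_left _ _
  have h2 : τ - δ / 2 ≤ a := le_max_right _ _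
  have haτ : a < τ := max_lt (by linarith) (by linarith)
  have ha := haI a h1 haτ.le
  have hZ := hB.memLp ha hτI haτ.le
  have hsol := hy.isCompanionSolution hI hU hm hc
    (fun k t ht => (hadapt k t ht).mono (𝓕.le t) le_rfl)
    (fun s hs t ht hst => hB.memLp hs ht hst) heq (e := 1) hZ ha hτI
    (fun k hk => by
      rw [covariance_comm]
      exact hB.covariance_eq_zero ha hτI haτ.le (hy.memLp hk ha) (hadapt ⟨k, hk⟩ a ha))
    (fun r hr => by
      rw [hB.covariance_increment ha (hI.out ha hτI hr) hτI hr.1 hr.2, one_mul])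
  have hpos := hsol.pos hm hK1 (fun r hr => hK r ⟨h1.trans hr.1, hr.2⟩)
    (hδK (by rw [Real.dist_eq, abs_lt]; constructor <;> linarith)) ⟨haτ, le_rfl⟩ hm
  have hL := hy.memLp_zero hm hτI
  rw [pathDeriv_zero] at hpos
  intro hzero
  rw [covKernel, covariance_self hL.aemeasurable] at hzero
  exact hpos.ne' (covariance_eq_zero_of_variance_eq_zero hL hzero)

/-- A variable that is known at the time `τ` and uncorrelated with the state at that time is
uncorrelated with the later states. -/
theorem IsDrivenBySDE.exists_filtration_covariance_eq_zero (hy : IsDrivenBySDE P I c y) (hI : I.OrdConnected)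
    (hU : UniqueDiffOn ℝ I) (hm : 0 < m) (hc : ∀ k, ContinuousOn (c k) I) :
    ∃ 𝓕 : Filtration ℝ mΩ, (∀ k < m, ∀ t ∈ I, Measurable[𝓕 t] (pathDeriv I y k t)) ∧
      ∀ τ ∈ I, ∀ t ∈ I, τ ≤ t → ∀ Z : Ω → ℝ, MemLp Z 2 P → Measurable[𝓕 τ] Z →
        (∀ k < m, cov[pathDeriv I y k τ, Z; P] = 0) → ∀ k < m, cov[pathDeriv I y k t, Z; P] = 0 := by
  obtain ⟨𝓕, B, hB, hadapt, heq⟩ := hy.equation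
  refine ⟨𝓕, fun k hk => hadapt ⟨k, hk⟩, fun τ hτ t ht hτt Z hZ hZm h0 k hk => ?_⟩
  have hsub : Icc τ t ⊆ I := hI.out hτ ht
  -- Increments after `τ` are independent of `Z`, so the right hand side is `e = 0`.
  have hsol := hy.isCompanionSolution hI hU hm hc
    (fun k t ht => (hadapt k t ht).mono (𝓕.le t) le_rfl)
    (fun s hs t ht hst => hB.memLp hs ht hst) heq (e := 0) hZ hτ ht h0
    (fun r hr => by rw [hB.covariance_eq_zero hτ (hsub hr) hr.1 hZ hZm, zero_mul])
  exact hsol.eq_zero (fun k => (hc k).mono hsub) ⟨hτt, le_rfl⟩ hk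

/-- The residual of `y^(i)(u)` on the state at `τ` is known at `τ`, hence uncorrelated with `y(s)`
for `s ≥ τ`; the regression coefficients do not depend on `s`. -/
theorem IsDrivenBySDE.kerDeriv_mem_derivSpan_left (hy : IsDrivenBySDE P I c y)
    (hI : I.OrdConnected) (hU : UniqueDiffOn ℝ I) (hm : 0 < m) (hc : ∀ k, ContinuousOn (c k) I)
    {τ : ℝ} (hτ : τ ∈ I) {u : ℝ} (hu : u ∈ I ∩ Iic τ) (i : Fin m) :
    (fun s : leftNodes I τ => kerDeriv I (covKernel P y) i u s)
      ∈ derivSpan I m (covKernel P y) τ (leftNodes I τ) := by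
  obtain ⟨𝓕, hadapt, hunc⟩ := hy.exists_filtration_covariance_eq_zero hI hU hm hc
  have hX := hy.memLp i.2 hu.1
  have hY := fun k : Fin m => hy.memLp k.2 hτ
  obtain ⟨β, hβ⟩ := exists_covariance_eq_sum hX hY
  have hS : MemLp (fun ω => ∑ k, β k * pathDeriv I y k τ ω) 2 P :=
    memLp_finsetSum _ fun k _ => (hY k).const_mul _
  have hS' : ∀ Z, MemLp Z 2 P → cov[fun ω => ∑ k, β k * pathDeriv I y k τ ω, Z; P]
      = ∑ k : Fin m, β k * cov[pathDeriv I y k τ, Z; P] := fun Z hZ => by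
    rw [covariance_fun_sum_left (fun k => (hY k).const_mul _) hZ]
    simp only [covariance_const_mul_left]
  have hmeas : Measurable[𝓕 τ]
      (pathDeriv I y i u - fun ω => ∑ k, β k * pathDeriv I y k τ ω) :=
    ((hadapt i i.2 u hu.1).mono (𝓕.mono hu.2) le_rfl).sub
      (Finset.measurable_fun_sum _ fun k _ => (hadapt k k.2 τ hτ).const_mul _)
  have h0 : ∀ k < m, cov[pathDeriv I y k τ,
      pathDeriv I y i u - fun ω => ∑ k, β k * pathDeriv I y k τ ω; P] = 0 := fun k hk => by
    rw [covariance_comm, covariance_sub_left hX hS (hy.memLp hk hτ), hS' _ (hy.memLp hk hτ),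
      hβ ⟨k, hk⟩, sub_self]
  have hfun : (fun s : leftNodes I τ => kerDeriv I (covKernel P y) i u s)
      = ∑ k : Fin m, β k • fun s : leftNodes I τ => kerDeriv I (covKernel P y) k τ s := by
    ext s
    have hsI := interior_subset s.2.1
    have h1 := hunc τ hτ s hsI s.2.2 _ (hX.sub hS) hmeas h0 0 hm
    have hys := hy.memLp_zero hm hsI
    rw [pathDeriv_zero, covariance_comm, covariance_sub_left hX hS hys, hS' _ hys] at h1
    rw [hy.kerDeriv_eq hU i.2 hu.1 hsI, Finset.sum_apply, sub_eq_zero.1 h1]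
    refine Finset.sum_congr rfl fun k _ => ?_
    rw [Pi.smul_apply, smul_eq_mul, hy.kerDeriv_eq hU k.2 hτ hsI]
  rw [hfun]
  exact Submodule.sum_mem _ fun k _ => Submodule.smul_mem _ _ (Submodule.subset_span ⟨k, rfl⟩)

/-- A function lies in a finite span as soon as it is annihilated by all finitely supported
functionals that annihilate the span. -/
theorem mem_span_range_of_forall_finsupp {N ι : Type*} [Finite ι] {f : ι → N → ℝ} {g : N → ℝ}
    (h : ∀ a : N →₀ ℝ, (∀ k, a.sum (fun s x => x * f k s) = 0) → a.sum (fun s x => x * g s) = 0) :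
    g ∈ Submodule.span ℝ (range f) := by
  have := Fintype.ofFinite ι
  have hmem : Finsupp.linearCombination ℝ g
      ∈ Submodule.span ℝ (range fun k => Finsupp.linearCombination ℝ (f k)) := by
    -- Functions on `N` are linear forms on `N →₀ ℝ`, where finitely many forms span every form
    -- vanishing on their common kernel.
    refine mem_span_of_iInf_ker_le_ker fun a ha => h a fun k => ?_
    exact LinearMap.mem_ker.1 ((Submodule.mem_iInf _).1 ha k)
  obtain ⟨β, hβ⟩ := (Submodule.mem_span_range_iff_exists_fun ℝ).1 hmem
  refine (Submodule.mem_span_range_iff_exists_fun ℝ).2 ⟨β, ?_⟩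
  ext s
  have := LinearMap.congr_fun hβ (Finsupp.single s 1)
  simpa using this

/-- Here the nodes lie in the past, so the test variable is `∑ a_s y(s)`: a functional annihilating
the derivatives at `τ` makes it uncorrelated with the state at `τ`, hence with all later states. -/
theorem IsDrivenBySDE.kerDeriv_mem_derivSpan_right (hy : IsDrivenBySDE P I c y)
    (hI : I.OrdConnected) (hU : UniqueDiffOn ℝ I) (hm : 0 < m) (hc : ∀ k, ContinuousOn (c k) I)
    {τ : ℝ} (hτ : τ ∈ I) {u : ℝ} (hu : u ∈ I ∩ Ici τ) (i : Fin m) :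
    (fun s : rightNodes I τ => kerDeriv I (covKernel P y) i u s)
      ∈ derivSpan I m (covKernel P y) τ (rightNodes I τ) := by
  obtain ⟨𝓕, hadapt, hunc⟩ := hy.exists_filtration_covariance_eq_zero hI hU hm hc
  refine mem_span_range_of_forall_finsupp fun a ha => ?_
  have hys := fun s : rightNodes I τ => hy.memLp_zero hm (interior_subset s.2.1)
  have hZ : MemLp (fun ω => ∑ s ∈ a.support, a s * y s ω) 2 P :=
    memLp_finsetSum _ fun s _ => (hys s).const_mul _
  have hcov : ∀ k < m, ∀ t ∈ I, cov[pathDeriv I y k t, fun ω => ∑ s ∈ a.support, a s * y s ω; P]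
      = a.sum fun s x => x * kerDeriv I (covKernel P y) k t s := fun k hk t ht => by
    rw [covariance_fun_sum_right' (fun s _ => (hys s).const_mul _) (hy.memLp hk ht)]
    refine Finset.sum_congr rfl fun s _ => ?_
    rw [covariance_const_mul_right, ← hy.kerDeriv_eq hU hk ht (interior_subset s.2.1)]
  have hmeas : Measurable[𝓕 τ] fun ω => ∑ s ∈ a.support, a s * y s ω := by
    refine Finset.measurable_fun_sum _ fun s _ => Measurable.const_mul ?_ _
    have := hadapt 0 hm s (interior_subset s.2.1)
    rw [pathDeriv_zero] at this
    exact this.mono (𝓕.mono s.2.2) le_rfl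
  rw [← hcov i i.2 u hu.1]
  exact hunc τ hτ u hu.1 hu.2 _ hZ hmeas
    (fun k hk => by rw [hcov k hk τ hτ]; exact ha ⟨k, hk⟩) i i.2

end DrivenProcess

end KernelPacket

end

theorem mainTheorem8
    (I : Set ℝ) (hI : I.OrdConnected) (m : ℕ) (hm : 0 < m)
    {Ω₁ : Type*} [MeasurableSpace Ω₁] (P₁ : Measure Ω₁) [IsProbabilityMeasure P₁]
    {Ω₂ : Type*} [MeasurableSpace Ω₂] (P₂ : Measure Ω₂) [IsProbabilityMeasure P₂]
    (c₁ c₂ : Fin m → ℝ → ℝ)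
    (hc₁ : ∀ k, ContinuousOn (c₁ k) I) (hc₂ : ∀ k, ContinuousOn (c₂ k) I)
    (hL₁ : KernelPacket.HasBoundedFundamentalSystem I c₁)
    (hL₂ : KernelPacket.HasBoundedFundamentalSystem I c₂)
    (y₁ : ℝ → Ω₁ → ℝ) (y₂ : ℝ → Ω₂ → ℝ)
    (hy₁ : KernelPacket.IsDrivenBySDE P₁ I c₁ y₁) (hy₂ : KernelPacket.IsDrivenBySDE P₂ I c₂ y₂)
    (K₁ K₂ : ℝ → ℝ → ℝ)
    (hK₁ : K₁ = KernelPacket.covKernel P₁ y₁) (hK₂ : K₂ = KernelPacket.covKernel P₂ y₂)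
    (τ : ℝ) (hτ : τ ∈ interior I) :
    -- the derivatives in the statement exist
    (∀ s ∈ I, ContDiffOn ℝ ((m - 1 : ℕ) : WithTop ℕ∞) (fun t => K₁ t s) I ∧
      ContDiffOn ℝ ((m - 1 : ℕ) : WithTop ℕ∞) (fun t => K₂ t s) I) ∧
    -- the left system, with first node `τ`
    (∀ (s₁ : ℕ) (ψ : Fin s₁ → KernelPacket.leftNodes I τ → ℝ),
      KernelPacket.IsMinimalSpanning ψ
        (KernelPacket.tensorSpan I m K₁ K₂ τ (KernelPacket.leftNodes I τ)) →
      KernelPacket.IsMinimalKPSystem I m K₁ K₂ τ (I ∩ Set.Iic τ) (KernelPacket.leftNodes I τ) ψ) ∧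
    -- the right system, with last node `τ`
    (∀ (s₂ : ℕ) (ζ : Fin s₂ → KernelPacket.rightNodes I τ → ℝ),
      KernelPacket.IsMinimalSpanning ζ
        (KernelPacket.tensorSpan I m K₁ K₂ τ (KernelPacket.rightNodes I τ)) →
      KernelPacket.IsMinimalKPSystem I m K₁ K₂ τ (I ∩ Set.Ici τ) (KernelPacket.rightNodes I τ) ζ) := by
  subst hK₁ hK₂
  have hU : UniqueDiffOn ℝ I := uniqueDiffOn_convex hI.convex ⟨τ, hτ⟩
  have hτI := interior_subset hτ
  have hne₁ := hy₁.covKernel_ne_zero hI hU hm hc₁ hτ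
  have hne₂ := hy₂.covKernel_ne_zero hI hU hm hc₂ hτ
  refine ⟨fun s hs => ⟨hy₁.contDiffOn_covKernel hU hm hs, hy₂.contDiffOn_covKernel hU hm hs⟩,
    fun s₁ ψ hψ => ?_, fun s₂ ζ hζ => ?_⟩
  · exact KernelPacket.isMinimalKPSystem_of_mem_derivSpan hm (E := I ∩ Set.Iic τ)
      (N := KernelPacket.leftNodes I τ) ⟨hτI, Set.mem_Iic.2 le_rfl⟩ ⟨hτ, Set.mem_Ici.2 le_rfl⟩
      (fun u hu i => hy₁.kerDeriv_mem_derivSpan_left hI hU hm hc₁ hτI hu i)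
      (fun u hu i => hy₂.kerDeriv_mem_derivSpan_left hI hU hm hc₂ hτI hu i) hne₁ hne₂ hψ
  · exact KernelPacket.isMinimalKPSystem_of_mem_derivSpan hm (E := I ∩ Set.Ici τ)
      (N := KernelPacket.rightNodes I τ) ⟨hτI, Set.mem_Ici.2 le_rfl⟩ ⟨hτ, Set.mem_Iic.2 le_rfl⟩
      (fun u hu i => hy₁.kerDeriv_mem_derivSpan_right hI hU hm hc₁ hτI hu i)
      (fun u hu i => hy₂.kerDeriv_mem_derivSpan_right hI hU hm hc₂ hτI hu i) hne₁ hne₂ hζ
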